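/- Let $d\ge 2$, let $\mu=(u_1,\dots,u_n)^T\in\mathbb{R}^n$ and $\nu=(v_1,\dots,v_m)^T\in\mathbb{R}^m$ be real vectors with Euclidean norms $|\mu|,|\nu|$, and let $\rho$ be a state (density matrix) on $\mathbb{C}^d\otimes\mathbb{C}^d\otimes\mathbb{C}^d$. Then $$C_{GME}(\rho)\;\ge\;\frac{1}{\sqrt{d(d-1)}}\left(\mathscr{Q}(\rho)-\sqrt{(|\mu|^2+1)(|\nu|^2+1)}-\frac{2(d-1)}{3}\right).$$ Here the notation is as follows. * For a matrix $X$, $\mathrm{Vec}(X)$ is the vector obtained by stacking its columns, and $\|X\|_{\mathrm{Tr}}=\mathrm{Tr}\sqrt{X^\dagger X}$. For a matrix $Z=(Z_{i,j})_{i,j=1}^{d_A}$ on $\mathbb{C}^{d_A}\otimes\mathbb{C}^{d_B}$ with blocks $Z_{i,j}\in\mathbb{C}^{d_B\times d_B}$, the realigned matrix $\mathcal{R}(Z)$ has rows $\mathrm{Vec}(Z_{1,1})^T,\dots,\mathrm{Vec}(Z_{d_A,1})^T,\dots,\mathrm{Vec}(Z_{1,d_A})^T,\dots,\mathrm{Vec}(Z_{d_A,d_A})^T$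 in this order. * For a bipartite state $\sigma$ on $\mathbb{C}^{d_A}\otimes\mathbb{C}^{d_B}$ with reduced matrices $\sigma_A=\mathrm{Tr}_B\,\sigma$ and $\sigma_B=\mathrm{Tr}_A\,\sigma$, $$\mathcal{Q}_{\mu,\nu}(\sigma)=\begin{pmatrix}\mu\nu^T & \mu\,\mathrm{Vec}(\sigma_B)^T\\ \mathrm{Vec}(\sigma_A)\,\nu^T & \mathcal{R}(\sigma)\end{pmatrix}.$$ * $\mathscr{Q}(\rho)=\frac13\left(\|\mathscr{Q}_{1|23}(\rho)\|_{\mathrm{Tr}}+\|\mathscr{Q}_{2|13}(\rho)\|_{\mathrm{Tr}}+\|\mathscr{Q}_{3|12}(\rho)\|_{\mathrm{Tr}}\right)$, where $\mathscr{Q}_{i|jk}(\rho)$ is the matrix $\mathcal{Q}_{\mu,\nu}$ of $\rho$ regarded as a bipartite state with $A=i$ and $B=jk$. * For a unit vector $|\varphi\rangle\in(\mathbb{C}^d)^{\otimes 3}$ with one-party reduced density matrices $\rho_1,\rho_2,\rho_3$, $C_{GME}(|\varphi\rangle)=\sqrt{\min\{1-\mathrm{Tr}(\rho_1^2),\,1-\mathrm{Tr}(\rho_2^2),\,1-\mathrm{Tr}(\rho_3^2)\}}$;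 and for a state $\rho$, $C_{GME}(\rho)$ is the infimum of $\sum_i p_i\,C_{GME}(|\varphi_i\rangle)$ over all finite decompositions $\rho=\sum_i p_i|\varphi_i\rangle\langle\varphi_i|$ into unit vectors with $p_i\ge0$, $\sum_i p_i=1$. -/

import Mathlib

open scoped ComplexOrder in
/-- A state (density matrix): positive semidefinite with unit trace. -/
def IsState {ι : Type*} [Fintype ι] (ρ : Matrix ι ι ℂ) : Prop :=
  ρ.PosSemidef ∧ ρ.trace = 1

open scoped MatrixOrder in
/-- The trace norm `Tr √(Aᴴ A)` (the trace of a positive semidefinite matrix is real). -/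
noncomputable def traceNorm {m n : Type*} [Fintype m] [Fintype n] [DecidableEq n]
    (A : Matrix m n ℂ) : ℝ :=
  (CFC.sqrt (A.conjTranspose * A)).trace.re

/-- The partial trace over the first subsystem; the result is the reduced matrix `ρ_B`. -/
def traceFst {A B : Type*} [Fintype A] (ρ : Matrix (A × B) (A × B) ℂ) : Matrix B B ℂ :=
  Matrix.of fun b b' => ∑ a, ρ (a, b) (a, b')

/-- The partial trace over the second subsystem; the result is the reduced matrix `ρ_A`. -/
def traceSnd {A B : Type*} [Fintype B] (ρ : Matrix (A × B) (A × B) ℂ) : Matrix A A ℂ :=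
  Matrix.of fun a a' => ∑ b, ρ (a, b) (a', b)

/-- The realigned matrix. The block `Z i j` has entries `Z (i, b) (j, b')`; the row of the
realigned matrix at `(j, i)` is the (column-stacking) vectorization of that block, the rows being
enumerated in the same column-major order as the entries of a vectorization. -/
def realign {A B : Type*} (Z : Matrix (A × B) (A × B) ℂ) : Matrix (A × A) (B × B) ℂ :=
  Matrix.of fun p => Matrix.vec (Z.submatrix (fun b => (p.2, b)) (fun b => (p.1, b)))

/-- The matrix `Q_{μ,ν}(ρ)` of a bipartite `ρ`, with blocks
`μ νᵀ`, `μ Vec(ρ_B)ᵀ`, `Vec(ρ_A) νᵀ` and the realigned matrix of `ρ`. -/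
noncomputable def Qmat {A B : Type*} [Fintype A] [Fintype B] {n m : ℕ}
    (μ : EuclideanSpace ℝ (Fin n)) (ν : EuclideanSpace ℝ (Fin m))
    (ρ : Matrix (A × B) (A × B) ℂ) : Matrix (Fin n ⊕ A × A) (Fin m ⊕ B × B) ℂ :=
  Matrix.fromBlocks
    (Matrix.vecMulVec (fun i => (μ i : ℂ)) (fun j => (ν j : ℂ)))
    (Matrix.vecMulVec (fun i => (μ i : ℂ)) (traceFst ρ).vec)
    (Matrix.vecMulVec (traceSnd ρ).vec (fun j => (ν j : ℂ)))
    (realign ρ)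

/-- Index set of the standard basis of `ℂ^d ⊗ ℂ^d ⊗ ℂ^d`. -/
abbrev Tri (d : ℕ) : Type := Fin d × Fin d × Fin d

/-- A tripartite matrix regarded as bipartite under the bipartition `1|23`. -/
def cut1 {d : ℕ} (ρ : Matrix (Tri d) (Tri d) ℂ) : Matrix (Tri d) (Tri d) ℂ :=
  ρ

/-- A tripartite matrix regarded as bipartite under the bipartition `2|13`: the index
`(j, (i, k))` stands for the basis vector `|i j k⟩`. -/
def cut2 {d : ℕ} (ρ : Matrix (Tri d) (Tri d) ℂ) : Matrix (Tri d) (Tri d) ℂ :=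
  ρ.submatrix (fun x => (x.2.1, x.1, x.2.2)) (fun x => (x.2.1, x.1, x.2.2))

/-- A tripartite matrix regarded as bipartite under the bipartition `3|12`: the index
`(k, (i, j))` stands for the basis vector `|i j k⟩`. -/
def cut3 {d : ℕ} (ρ : Matrix (Tri d) (Tri d) ℂ) : Matrix (Tri d) (Tri d) ℂ :=
  ρ.submatrix (fun x => (x.2.1, x.2.2, x.1)) (fun x => (x.2.1, x.2.2, x.1))

/-- The average of the trace norms of `Q_{μ,ν}` over the three bipartitions. -/
noncomputable def Qavg {d n m : ℕ}
    (μ : EuclideanSpace ℝ (Fin n)) (ν : EuclideanSpace ℝ (Fin m))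
    (ρ : Matrix (Tri d) (Tri d) ℂ) : ℝ :=
  (1 / 3) * (traceNorm (Qmat μ ν (cut1 ρ)) + traceNorm (Qmat μ ν (cut2 ρ))
    + traceNorm (Qmat μ ν (cut3 ρ)))

/-- The matrix `|φ⟩⟨φ|`. -/
noncomputable def ketbra {ι : Type*} (φ : EuclideanSpace ℂ ι) : Matrix ι ι ℂ :=
  Matrix.vecMulVec (fun i => φ i) (fun i => star (φ i))

/-- The purity `Tr σ²`, which is real for Hermitian `σ`. -/
noncomputable def purity {ι : Type*} [Fintype ι] (σ : Matrix ι ι ℂ) : ℝ :=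
  (σ * σ).trace.re

/-- The GME concurrence of a (unit) vector `φ` of `ℂ^d ⊗ ℂ^d ⊗ ℂ^d`. -/
noncomputable def pureGME {d : ℕ} (φ : EuclideanSpace ℂ (Tri d)) : ℝ :=
  √(min (1 - purity (traceSnd (cut1 (ketbra φ))))
    (min (1 - purity (traceSnd (cut2 (ketbra φ))))
      (1 - purity (traceSnd (cut3 (ketbra φ))))))

/-- `(p, φ)` is a (finite) pure-state ensemble decomposition of `ρ`. -/
def IsEnsemble {ι : Type*} [Fintype ι] (ρ : Matrix ι ι ℂ) {N : ℕ} (p : Fin N → ℝ)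
    (φ : Fin N → EuclideanSpace ℂ ι) : Prop :=
  (∀ i, 0 ≤ p i) ∧ ∑ i, p i = 1 ∧ (∀ i, ‖φ i‖ = 1) ∧ ρ = ∑ i, (p i : ℂ) • ketbra (φ i)

/-- The average pure-state GME concurrences of all ensemble decompositions of `ρ`. -/
def ensembleGME {d : ℕ} (ρ : Matrix (Tri d) (Tri d) ℂ) : Set ℝ :=
  {x | ∃ (N : ℕ) (p : Fin N → ℝ) (φ : Fin N → EuclideanSpace ℂ (Tri d)),
    IsEnsemble ρ p φ ∧ x = ∑ i, p i * pureGME (φ i)}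

/-- The GME concurrence of a state `ρ`: the convex roof of the pure-state one. -/
noncomputable def GMEConcurrence {d : ℕ} (ρ : Matrix (Tri d) (Tri d) ℂ) : ℝ :=
  sInf (ensembleGME ρ)

open scoped ComplexOrder in
/-- Every state has an ensemble decomposition, so the infimum is over a nonempty set. -/
theorem ensembleGME_nonempty {d : ℕ} {ρ : Matrix (Tri d) (Tri d) ℂ} (hρ : IsState ρ) :
    (ensembleGME ρ).Nonempty := by
  obtain ⟨hpos, htr⟩ := hρ
  have hH := hpos.isHermitian
  let e := (Fintype.equivFin (Tri d)).symm
  refine ⟨_, _, fun i => hH.eigenvalues (e i), fun i => hH.eigenvectorBasis (e i),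
    ⟨fun i => hpos.eigenvalues_nonneg _, ?_, fun i => hH.eigenvectorBasis.orthonormal.1 _, ?_⟩, rfl⟩
  · rw [e.sum_comp (fun i => hH.eigenvalues i)]
    have h := hH.trace_eq_sum_eigenvalues
    rw [htr] at h
    have h2 : ((∑ i, hH.eigenvalues i : ℝ) : ℂ) = 1 := by
      rw [h]; push_cast; rfl
    exact_mod_cast h2
  · rw [e.sum_comp (fun i => (hH.eigenvalues i : ℂ) • ketbra (hH.eigenvectorBasis i))]
    conv_lhs => rw [hH.spectral_theorem, Unitary.conjStarAlgAut_apply]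
    ext x y
    rw [Matrix.mul_apply, Matrix.sum_apply]
    refine Finset.sum_congr rfl fun j _ => ?_
    simp [Matrix.mul_diagonal, ketbra, Matrix.vecMulVec_apply, Matrix.star_apply]
    ring

/-- The values are nonnegative, so the infimum is over a set that is bounded below. -/
theorem ensembleGME_bddBelow {d : ℕ} (ρ : Matrix (Tri d) (Tri d) ℂ) :
    BddBelow (ensembleGME ρ) := by
  refine ⟨0, ?_⟩
  rintro x ⟨N, p, φ, h, rfl⟩
  exact Finset.sum_nonneg fun i _ => mul_nonneg (h.1 i) (Real.sqrt_nonneg _)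

/-! Across one cut, let a unit vector have Schmidt coefficients `s k`, so `∑ k, s k ^ 2 = 1`. Its
`Qmat` is a sum of rank one matrices: for each `k` one of norm `s k ^ 2 * √((‖μ‖ ^ 2 + 1) * (‖ν‖ ^ 2
+ 1))`, carrying the `μ`, `ν` borders, and for each `k ≠ l` one of norm `s k * s l`
(`Qmat_ketbra_eq_sum`). The trace norm therefore exceeds the square root by at most `∑_{k≠l} s k * s
l`. Cauchy–Schwarz bounds this excess by `√(d(d-1)) * √(1 - Tr ρ_A²)`, and also by `d - 1`. The
first bound is used on the cut with the smallest `1 - Tr ρ_A²` and the second on the other two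
(`sum_min_le_mul_sqrt_min`). Mixed states follow because `Qmat` is affine and the trace norm is
attained by a single linear functional, which is then estimated on each pure state of an arbitrary
ensemble. -/

/-! ### Duality for the trace norm -/

open scoped MatrixOrder ComplexOrder in
/-- A singular value decomposition: after a unitary change of basis the columns of a matrix are
orthogonal, and the trace norm is the sum of their lengths. -/
theorem exists_unitary_orthogonal_columns {m n : Type*} [Fintype m] [Fintype n] [DecidableEq n]
    (A : Matrix m n ℂ) :
    ∃ (V : Matrix n n ℂ) (s : n → ℝ), V.conjTranspose * V = 1 ∧ V * V.conjTranspose = 1 ∧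
      (∀ j, 0 ≤ s j) ∧
      (A * V).conjTranspose * (A * V) = Matrix.diagonal (fun j => ((s j : ℂ)) ^ 2) ∧
      traceNorm A = ∑ j, s j := by
  have hpos : (A.conjTranspose * A).PosSemidef := Matrix.posSemidef_conjTranspose_mul_self A
  have hH := hpos.isHermitian
  have hV1 : (hH.eigenvectorUnitary : Matrix n n ℂ).conjTranspose * hH.eigenvectorUnitary = 1 :=
    Unitary.coe_star_mul_self hH.eigenvectorUnitary
  have hV2 : (hH.eigenvectorUnitary : Matrix n n ℂ) *
      (hH.eigenvectorUnitary : Matrix n n ℂ).conjTranspose = 1 :=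
    Unitary.coe_mul_star_self hH.eigenvectorUnitary
  refine ⟨hH.eigenvectorUnitary, fun j => √(hH.eigenvalues j), hV1, hV2,
    fun j => Real.sqrt_nonneg _, ?_, ?_⟩
  · have h := hH.spectral_theorem
    rw [Unitary.conjStarAlgAut_apply] at h
    have h' := congrArg (fun X => (hH.eigenvectorUnitary : Matrix n n ℂ).conjTranspose * X *
      (hH.eigenvectorUnitary : Matrix n n ℂ)) h
    simp only [Matrix.star_eq_conjTranspose] at h'
    rw [Matrix.conjTranspose_mul]
    simp only [← Matrix.mul_assoc] at h' ⊢
    rw [h', hV1, Matrix.one_mul, Matrix.mul_assoc, hV1, Matrix.mul_one]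
    congr 1
    ext j
    simp only [Function.comp_apply]
    rw [← Complex.ofReal_pow, Real.sq_sqrt (hpos.eigenvalues_nonneg j)]
    rfl
  · unfold traceNorm
    rw [CFC.sqrt_eq_real_sqrt _ hpos.nonneg, cfcₙ_eq_cfc (hf0 := Real.sqrt_zero), hH.cfc_eq,
      Matrix.IsHermitian.cfc, Unitary.conjStarAlgAut_apply, Matrix.trace_mul_comm,
      ← Matrix.mul_assoc, Unitary.coe_star_mul_self, Matrix.one_mul, Matrix.trace_diagonal]
    simp

open scoped Matrix.Norms.L2Operator in
/-- The trace norm is attained by a linear functional that is contractive on rank one matrices. -/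
theorem exists_traceNorm_eq_trace_mul {m n : Type*} [Fintype m] [Fintype n] [DecidableEq m]
    [DecidableEq n] (A : Matrix m n ℂ) :
    ∃ W : Matrix n m ℂ, traceNorm A = (W * A).trace.re ∧ ∀ (x : m → ℂ) (y : n → ℂ),
      (W * Matrix.vecMulVec x y).trace.re ≤ ‖WithLp.toLp 2 x‖ * ‖WithLp.toLp 2 y‖ := by
  obtain ⟨V, s, hV, -, -, hs, hA⟩ := exists_unitary_orthogonal_columns A
  -- Since `0⁻¹ = 0`, `D` inverts only the nonzero singular values, and `A * V * D` is a partial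
  -- isometry.
  set D : Matrix n n ℂ := Matrix.diagonal (fun j => ((s j : ℂ))⁻¹) with hD
  have hDs : D.conjTranspose = D := by
    rw [hD, Matrix.diagonal_conjTranspose]
    congr 1
    ext j
    simp
  have hV1 : ‖V‖ ≤ 1 := by
    have h := Matrix.l2_opNorm_conjTranspose_mul_self V
    rw [hV, ← Matrix.diagonal_one, Matrix.l2_opNorm_diagonal] at h
    have h1 : ‖fun _ : n => (1 : ℂ)‖ ≤ 1 := (pi_norm_le_iff_of_nonneg zero_le_one).2 fun i => by simp
    nlinarith [norm_nonneg V]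
  have hU1 : ‖A * V * D‖ ≤ 1 := by
    have h := Matrix.l2_opNorm_conjTranspose_mul_self (A * V * D)
    rw [Matrix.conjTranspose_mul, hDs, Matrix.mul_assoc, ← Matrix.mul_assoc _ (A * V) D, hs, hD,
      Matrix.diagonal_mul_diagonal, Matrix.diagonal_mul_diagonal, Matrix.l2_opNorm_diagonal] at h
    have h1 : ‖fun i => ((s i : ℂ))⁻¹ * ((s i : ℂ) ^ 2 * ((s i : ℂ))⁻¹)‖ ≤ 1 :=
      (pi_norm_le_iff_of_nonneg zero_le_one).2 fun i => by
        by_cases h0 : (s i : ℂ) = 0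
        · simp [h0]
        · have : ((s i : ℂ))⁻¹ * ((s i : ℂ) ^ 2 * ((s i : ℂ))⁻¹) = 1 := by field_simp
          simp [this]
    nlinarith [norm_nonneg (A * V * D)]
  -- The adjoint of the polar part of `A`: by cyclicity the trace of its product with `A` is `∑ s⁻¹
  -- s² = ∑ s`.
  refine ⟨V * (A * V * D).conjTranspose, ?_, fun x y => ?_⟩
  · rw [hA, Matrix.mul_assoc, Matrix.trace_mul_comm, Matrix.mul_assoc, Matrix.conjTranspose_mul,
      hDs, Matrix.mul_assoc, hs, hD, Matrix.diagonal_mul_diagonal, Matrix.trace_diagonal,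
      Complex.re_sum]
    refine Finset.sum_congr rfl fun j _ => ?_
    by_cases h0 : (s j : ℂ) = 0
    · rw [h0]; simpa using h0
    · rw [sq, inv_mul_cancel_left₀ h0, Complex.ofReal_re]
  · have hW : ‖V * (A * V * D).conjTranspose‖ ≤ 1 := by
      refine (Matrix.l2_opNorm_mul _ _).trans ?_
      rw [Matrix.l2_opNorm_conjTranspose]
      exact mul_le_one₀ hV1 (norm_nonneg _) hU1
    set W := V * (A * V * D).conjTranspose
    have h1 : (W * Matrix.vecMulVec x y).trace =
        inner ℂ (WithLp.toLp 2 (star y)) (WithLp.toLp 2 (W.mulVec x)) := by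
      rw [Matrix.mul_vecMulVec, Matrix.trace_vecMulVec, EuclideanSpace.inner_eq_star_dotProduct]
      simp
    have h2 : ‖WithLp.toLp 2 (star y)‖ = ‖WithLp.toLp 2 y‖ := by
      simp [EuclideanSpace.norm_eq]
    have h3 : ‖WithLp.toLp 2 (W.mulVec x)‖ ≤ ‖WithLp.toLp 2 x‖ := by
      have := Matrix.l2_opNorm_mulVec W (WithLp.toLp 2 x)
      refine this.trans ?_
      exact mul_le_of_le_one_left (norm_nonneg _) hW
    calc _ ≤ ‖(W * Matrix.vecMulVec x y).trace‖ := Complex.re_le_norm _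
      _ ≤ ‖WithLp.toLp 2 (star y)‖ * ‖WithLp.toLp 2 (W.mulVec x)‖ := by
        rw [h1]; exact norm_inner_le_norm _ _
      _ ≤ ‖WithLp.toLp 2 y‖ * ‖WithLp.toLp 2 x‖ := by
        rw [h2]; gcongr
      _ = _ := mul_comm _ _

/-! ### Schmidt decomposition of `Qmat` on pure states -/

/-- The Schmidt decomposition of a bipartite vector, in matrix form. -/
theorem exists_schmidt {A B : Type*} [Fintype A] [Fintype B] [DecidableEq A] (M : Matrix A B ℂ) :
    ∃ (V : Matrix A A ℂ) (G : Matrix A B ℂ) (s : A → ℝ), V.conjTranspose * V = 1 ∧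
      (∀ k, 0 ≤ s k) ∧ G * G.conjTranspose = Matrix.diagonal (fun k => ((s k : ℂ)) ^ 2) ∧
      M = V * G := by
  obtain ⟨V, s, hV, hV', h0, hs, -⟩ := exists_unitary_orthogonal_columns M.conjTranspose
  refine ⟨V, V.conjTranspose * M, s, hV, h0, ?_, ?_⟩
  · simpa [Matrix.conjTranspose_mul] using hs
  · rw [← Matrix.mul_assoc, hV', Matrix.one_mul]

theorem norm_toLp_sumElim_sq {α β : Type*} [Fintype α] [Fintype β] (x : α → ℂ) (y : β → ℂ) :
    ‖WithLp.toLp 2 (Sum.elim x y)‖ ^ 2 = ∑ i, ‖x i‖ ^ 2 + ∑ j, ‖y j‖ ^ 2 := by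
  simp [EuclideanSpace.norm_sq_eq]

/-- The vectorization of the rank one matrix with entries `f i * star (g j)`. -/
def vecKetbra {α : Type*} (f g : α → ℂ) : α × α → ℂ := fun p => f p.2 * star (g p.1)

theorem sum_norm_vecKetbra_sq {α : Type*} [Fintype α] (f g : α → ℂ) :
    ∑ p, ‖vecKetbra f g p‖ ^ 2 = (∑ i, ‖f i‖ ^ 2) * ∑ i, ‖g i‖ ^ 2 := by
  simp only [vecKetbra, norm_mul, norm_star, mul_pow, Fintype.sum_prod_type]
  rw [Finset.sum_comm, Finset.sum_mul_sum]

theorem norm_sq_eq_conjTranspose_mul {α β : Type*} [Fintype α] (V : Matrix α β ℂ) (k : β) :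
    ((∑ a, ‖V a k‖ ^ 2 : ℝ) : ℂ) = (V.conjTranspose * V) k k := by
  simp [Matrix.mul_apply, Complex.conj_mul']

theorem norm_sq_eq_mul_conjTranspose {α β : Type*} [Fintype β] (G : Matrix α β ℂ) (k : α) :
    ((∑ b, ‖G k b‖ ^ 2 : ℝ) : ℂ) = (G * G.conjTranspose) k k := by
  simp [Matrix.mul_apply, Complex.mul_conj']

/-- The coefficient matrix of a bipartite vector. -/
def coeffMatrix {A B : Type*} (φ : EuclideanSpace ℂ (A × B)) : Matrix A B ℂ :=
  Matrix.of fun a b => φ (a, b)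

theorem traceSnd_ketbra {A B : Type*} [Fintype B] (φ : EuclideanSpace ℂ (A × B)) :
    traceSnd (ketbra φ) = coeffMatrix φ * (coeffMatrix φ).conjTranspose := by
  ext a a'
  simp [traceSnd, ketbra, coeffMatrix, Matrix.mul_apply, Matrix.vecMulVec_apply]

/-- The indices are swapped because `ρ_B` is the transpose of `MᴴM` for the coefficient matrix `M`.
-/
theorem traceFst_ketbra_apply {A B : Type*} [Fintype A] (φ : EuclideanSpace ℂ (A × B)) (b b' : B) :
    traceFst (ketbra φ) b b' = ((coeffMatrix φ).conjTranspose * coeffMatrix φ) b' b := by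
  simp [traceFst, ketbra, coeffMatrix, Matrix.mul_apply, Matrix.vecMulVec_apply, mul_comm]

/-- For a pure state, `Q_{μ,ν}` is a sum of rank one matrices read off a Schmidt decomposition. -/
theorem Qmat_ketbra_eq_sum {A B : Type*} [Fintype A] [Fintype B] [DecidableEq A] {n m : ℕ}
    (μ : EuclideanSpace ℝ (Fin n)) (ν : EuclideanSpace ℝ (Fin m))
    (φ : EuclideanSpace ℂ (A × B)) (V : Matrix A A ℂ) (G : Matrix A B ℂ) (s : A → ℝ)
    (hV : V.conjTranspose * V = 1)
    (hG : G * G.conjTranspose = Matrix.diagonal (fun k => ((s k : ℂ)) ^ 2))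
    (hφ : coeffMatrix φ = V * G) (hs : ∑ k, s k ^ 2 = 1) :
    Qmat μ ν (ketbra φ) =
      ∑ k, Matrix.vecMulVec
        (Sum.elim (fun i => (s k : ℂ) * μ i) (fun p => s k * vecKetbra (fun a => V a k)
          (fun a => V a k) p))
        (Sum.elim (fun j => (s k : ℂ) * ν j) (fun q => (s k : ℂ)⁻¹ * vecKetbra (G k) (G k) q)) +
      ∑ k, ∑ l ∈ Finset.univ.erase k, Matrix.vecMulVec
        (Sum.elim (0 : Fin n → ℂ) (vecKetbra (fun a => V a k) (fun a => V a l)))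
        (Sum.elim (0 : Fin m → ℂ) (vecKetbra (G k) (G l))) := by
  have hsC : ∑ k, (s k : ℂ) ^ 2 = 1 := by exact_mod_cast hs
  -- Row `k` of `G` has norm `s k`, so it vanishes with `s k`, and the convention `0⁻¹ = 0` does no
  -- harm.
  have hG0 : ∀ k, (s k : ℂ) = 0 → ∀ b, G k b = 0 := by
    intro k hk b
    have h := norm_sq_eq_mul_conjTranspose G k
    rw [hG, Matrix.diagonal_apply_eq, hk] at h
    have h' : ∑ b, ‖G k b‖ ^ 2 = 0 := by
      rw [zero_pow two_ne_zero] at h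
      exact_mod_cast h
    rw [Finset.sum_eq_zero_iff_of_nonneg (fun _ _ => by positivity)] at h'
    simpa using h' b (Finset.mem_univ b)
  have hcan : ∀ k b c, (s k : ℂ) * ((s k : ℂ)⁻¹ * (G k b * c)) = G k b * c := by
    intro k b c
    by_cases h0 : (s k : ℂ) = 0
    · simp [h0, hG0 k h0 b]
    · field_simp
  have hB : ∀ b b', traceFst (ketbra φ) b b' = ∑ k, G k b * star (G k b') := by
    intro b b'
    rw [traceFst_ketbra_apply, hφ, Matrix.conjTranspose_mul, Matrix.mul_assoc,
      ← Matrix.mul_assoc _ V, hV, Matrix.one_mul]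
    simp [Matrix.mul_apply, mul_comm]
  have hA : ∀ a a', traceSnd (ketbra φ) a a' = ∑ k, (s k : ℂ) ^ 2 * (V a k * star (V a' k)) := by
    intro a a'
    rw [traceSnd_ketbra, hφ, Matrix.conjTranspose_mul, Matrix.mul_assoc, ← Matrix.mul_assoc G, hG,
      Matrix.mul_apply]
    refine Finset.sum_congr rfl fun k _ => ?_
    simp [Matrix.diagonal_mul]
    ring
  have hφ' : ∀ a b, φ (a, b) = ∑ k, V a k * G k b := fun a b => by
    rw [← Matrix.mul_apply, ← hφ]; rfl
  ext x y
  simp only [Matrix.add_apply, Matrix.sum_apply, Matrix.vecMulVec_apply]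
  rcases x with i | p <;> rcases y with j | q
  · simp only [Qmat, Matrix.fromBlocks_apply₁₁, Matrix.vecMulVec_apply, Sum.elim_inl,
      Pi.zero_apply, zero_mul, Finset.sum_const_zero, add_zero]
    calc _ = (∑ k, (s k : ℂ) ^ 2) * ((μ i : ℂ) * ν j) := by rw [hsC, one_mul]
      _ = _ := by
        rw [Finset.sum_mul]
        exact Finset.sum_congr rfl fun k _ => by ring
  · simp only [Qmat, Matrix.fromBlocks_apply₁₂, Matrix.vecMulVec_apply, Sum.elim_inl,
      Sum.elim_inr, Pi.zero_apply, zero_mul, Finset.sum_const_zero, add_zero, Matrix.vec, hB,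
      Finset.mul_sum, vecKetbra]
    refine Finset.sum_congr rfl fun k _ => ?_
    linear_combination -(μ i : ℂ) * hcan k q.2 (star (G k q.1))
  · simp only [Qmat, Matrix.fromBlocks_apply₂₁, Matrix.vecMulVec_apply, Sum.elim_inl,
      Sum.elim_inr, Pi.zero_apply, mul_zero, Finset.sum_const_zero, add_zero, Matrix.vec, hA,
      Finset.sum_mul, vecKetbra]
    exact Finset.sum_congr rfl fun k _ => by ring
  · simp only [Qmat, Matrix.fromBlocks_apply₂₂, realign, Matrix.of_apply, Matrix.vec,
      Matrix.submatrix_apply, ketbra, Matrix.vecMulVec_apply, Sum.elim_inr, hφ', star_sum,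
      Finset.sum_mul_sum, vecKetbra]
    rw [← Finset.sum_add_distrib]
    refine Finset.sum_congr rfl fun k _ => ?_
    -- The terms with `l = k` of the double Schmidt sum belong to the bordered matrices, the rest to
    -- the off-diagonal ones.
    rw [← Finset.add_sum_erase _ _ (Finset.mem_univ k)]
    congr 1
    · rw [star_mul']
      linear_combination -(V p.2 k * star (V p.1 k)) * hcan k q.2 (star (G k q.1))
    · exact Finset.sum_congr rfl fun l _ => by rw [star_mul']; ring

/-- A Schmidt decomposition bounds every contractive functional of `Q_{μ,ν}` of a pure state. -/
theorem re_trace_mul_Qmat_ketbra_le {A B : Type*} [Fintype A] [Fintype B] [DecidableEq A]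
    {n m : ℕ} (μ : EuclideanSpace ℝ (Fin n)) (ν : EuclideanSpace ℝ (Fin m))
    (φ : EuclideanSpace ℂ (A × B)) (V : Matrix A A ℂ) (G : Matrix A B ℂ) (s : A → ℝ)
    (hV : V.conjTranspose * V = 1) (hs0 : ∀ k, 0 ≤ s k)
    (hG : G * G.conjTranspose = Matrix.diagonal (fun k => ((s k : ℂ)) ^ 2))
    (hφ : coeffMatrix φ = V * G) (hs : ∑ k, s k ^ 2 = 1)
    (W : Matrix (Fin m ⊕ B × B) (Fin n ⊕ A × A) ℂ)
    (hW : ∀ x y, (W * Matrix.vecMulVec x y).trace.re ≤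
      ‖WithLp.toLp 2 x‖ * ‖WithLp.toLp 2 y‖) :
    (W * Qmat μ ν (ketbra φ)).trace.re ≤
      √((‖μ‖ ^ 2 + 1) * (‖ν‖ ^ 2 + 1)) + ∑ k, ∑ l ∈ Finset.univ.erase k, s k * s l := by
  have hVn : ∀ k, ∑ a, ‖V a k‖ ^ 2 = 1 := fun k => by
    have h := norm_sq_eq_conjTranspose_mul V k
    rw [hV, Matrix.one_apply_eq] at h
    exact_mod_cast h
  have hGn : ∀ k, ∑ b, ‖G k b‖ ^ 2 = s k ^ 2 := fun k => by
    have h := norm_sq_eq_mul_conjTranspose G k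
    rw [hG, Matrix.diagonal_apply_eq] at h
    exact_mod_cast h
  have hnorm : ∀ {k : ℕ} (x : EuclideanSpace ℝ (Fin k)) (c : ℝ),
      ∑ i, ‖(c : ℂ) * (x i : ℂ)‖ ^ 2 = c ^ 2 * ‖x‖ ^ 2 := fun x c => by
    simp [EuclideanSpace.norm_sq_eq, Finset.mul_sum, mul_pow]
  rw [Qmat_ketbra_eq_sum μ ν φ V G s hV hG hφ hs, Matrix.mul_add, Matrix.trace_add,
    Complex.add_re]
  simp only [Matrix.mul_sum, Matrix.trace_sum, Complex.re_sum]
  refine add_le_add ?_ (Finset.sum_le_sum fun k _ => Finset.sum_le_sum fun l _ => ?_)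
  · calc _ ≤ ∑ k, s k ^ 2 * √((‖μ‖ ^ 2 + 1) * (‖ν‖ ^ 2 + 1)) := ?_
      _ = _ := by rw [← Finset.sum_mul, hs, one_mul]
    refine Finset.sum_le_sum fun k _ => (hW _ _).trans ?_
    rw [Real.sqrt_mul (by positivity)]
    -- The columns of `V` are unit vectors and `vecKetbra (G k) (G k)` has norm `s k ^ 2`; the
    -- factors `s k` and `(s k)⁻¹` balance the two sides, each getting one `s k`.
    have h1 : ‖WithLp.toLp 2 (Sum.elim (fun i => (s k : ℂ) * μ i)
        (fun p => s k * vecKetbra (fun a => V a k) (fun a => V a k) p))‖ =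
        s k * √(‖μ‖ ^ 2 + 1) := by
      rw [← sq_eq_sq₀ (norm_nonneg _) (mul_nonneg (hs0 k) (Real.sqrt_nonneg _)),
        norm_toLp_sumElim_sq, hnorm, mul_pow, Real.sq_sqrt (by positivity)]
      simp only [norm_mul, mul_pow, ← Finset.mul_sum, sum_norm_vecKetbra_sq, hVn,
        Complex.norm_real, Real.norm_eq_abs, sq_abs]
      ring
    have h2 : ‖WithLp.toLp 2 (Sum.elim (fun j => (s k : ℂ) * ν j)
        (fun q => (s k : ℂ)⁻¹ * vecKetbra (G k) (G k) q))‖ = s k * √(‖ν‖ ^ 2 + 1) := by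
      rw [← sq_eq_sq₀ (norm_nonneg _) (mul_nonneg (hs0 k) (Real.sqrt_nonneg _)),
        norm_toLp_sumElim_sq, hnorm, mul_pow, Real.sq_sqrt (by positivity)]
      simp only [norm_mul, mul_pow, ← Finset.mul_sum, sum_norm_vecKetbra_sq, hGn, norm_inv,
        Complex.norm_real, Real.norm_eq_abs, inv_pow, sq_abs]
      by_cases h0 : s k = 0
      · simp [h0]
      · field_simp
    rw [h1, h2]
    exact le_of_eq (by ring)
  · refine (hW _ _).trans (le_of_eq ?_)
    have h1 : ‖WithLp.toLp 2 (Sum.elim (0 : Fin n → ℂ)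
        (vecKetbra (fun a => V a k) (fun a => V a l)))‖ = 1 := by
      rw [← sq_eq_sq₀ (norm_nonneg _) zero_le_one, norm_toLp_sumElim_sq, sum_norm_vecKetbra_sq,
        hVn, hVn]
      simp
    have h2 : ‖WithLp.toLp 2 (Sum.elim (0 : Fin m → ℂ) (vecKetbra (G k) (G l)))‖ =
        s k * s l := by
      rw [← sq_eq_sq₀ (norm_nonneg _) (mul_nonneg (hs0 k) (hs0 l)), norm_toLp_sumElim_sq,
        sum_norm_vecKetbra_sq, hGn, hGn]
      simp [mul_pow]
    rw [h1, h2, one_mul]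

/-! ### Bounds on the off-diagonal excess -/

/-- For Schmidt coefficients `s`, the sum of the off-diagonal products `s k * s l`. -/
theorem sum_erase_mul_eq {A : Type*} [Fintype A] [DecidableEq A] (s : A → ℝ) :
    ∑ k, ∑ l ∈ Finset.univ.erase k, s k * s l = (∑ k, s k) ^ 2 - ∑ k, s k ^ 2 := by
  rw [sq (∑ k, s k), Finset.sum_mul_sum, ← Finset.sum_sub_distrib]
  refine Finset.sum_congr rfl fun k _ => ?_
  rw [← Finset.add_sum_erase _ _ (Finset.mem_univ k)]
  ring

theorem sum_erase_mul_le_card_sub_one {A : Type*} [Fintype A] [DecidableEq A] (s : A → ℝ)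
    (hs : ∑ k, s k ^ 2 = 1) :
    ∑ k, ∑ l ∈ Finset.univ.erase k, s k * s l ≤ (Fintype.card A : ℝ) - 1 := by
  rw [sum_erase_mul_eq, hs]
  have h := sq_sum_le_card_mul_sum_sq (s := (Finset.univ : Finset A)) (f := s)
  rw [hs, mul_one, Finset.card_univ] at h
  linarith

/-- Cauchy–Schwarz over the `d(d-1)` ordered pairs `k ≠ l`, where the squares `s k ^ 2 * s l ^ 2`
add up to `1 - ∑ k, s k ^ 4`. -/
theorem sum_erase_mul_le_sqrt {A : Type*} [Fintype A] [DecidableEq A] (s : A → ℝ)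
    (hs : ∑ k, s k ^ 2 = 1) :
    ∑ k, ∑ l ∈ Finset.univ.erase k, s k * s l ≤
      √((Fintype.card A : ℝ) * ((Fintype.card A : ℝ) - 1)) * √(1 - ∑ k, s k ^ 4) := by
  have hne : Nonempty A := by
    by_contra h
    rw [not_nonempty_iff] at h
    simp at hs
  have hc : (1 : ℝ) ≤ Fintype.card A := by exact_mod_cast Fintype.card_pos
  rw [← Real.sqrt_mul (by nlinarith)]
  refine Real.le_sqrt_of_sq_le ?_
  have hsq : ∑ k, ∑ l ∈ Finset.univ.erase k, (s k * s l) ^ 2 = 1 - ∑ k, s k ^ 4 := by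
    have h := sum_erase_mul_eq (fun k => s k ^ 2)
    simp only [← mul_pow, hs, one_pow] at h
    rw [h]
    simp [← pow_mul]
  rw [← hsq, Finset.sum_sigma', Finset.sum_sigma']
  refine sq_sum_le_card_mul_sum_sq.trans (le_of_eq ?_)
  congr 1
  rw [Finset.card_sigma]
  simp [Finset.card_erase_of_mem, Nat.cast_sub Fintype.card_pos]

/-- The reduced matrix is `V diag(s²) Vᴴ`, so its eigenvalues are the `s k ^ 2`. -/
theorem purity_traceSnd_ketbra {A B : Type*} [Fintype A] [Fintype B] [DecidableEq A]
    (φ : EuclideanSpace ℂ (A × B)) (V : Matrix A A ℂ) (G : Matrix A B ℂ) (s : A → ℝ)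
    (hV : V.conjTranspose * V = 1)
    (hG : G * G.conjTranspose = Matrix.diagonal (fun k => ((s k : ℂ)) ^ 2))
    (hφ : coeffMatrix φ = V * G) : purity (traceSnd (ketbra φ)) = ∑ k, s k ^ 4 := by
  have h : traceSnd (ketbra φ) =
      V * (Matrix.diagonal (fun k => ((s k : ℂ)) ^ 2) * V.conjTranspose) := by
    rw [traceSnd_ketbra, hφ, Matrix.conjTranspose_mul, Matrix.mul_assoc, ← Matrix.mul_assoc G, hG]
  rw [purity, h, Matrix.mul_assoc, Matrix.trace_mul_comm, ← Matrix.mul_assoc _ V,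
    Matrix.mul_assoc (Matrix.diagonal _) _ V, hV, Matrix.mul_one, Matrix.mul_assoc,
    Matrix.mul_assoc, hV, Matrix.mul_one,
    Matrix.diagonal_mul_diagonal, Matrix.trace_diagonal, Complex.re_sum]
  refine Finset.sum_congr rfl fun k _ => ?_
  norm_cast
  ring

theorem sum_sq_eq_one_of_norm_eq_one {A B : Type*} [Fintype A] [Fintype B] [DecidableEq A]
    (φ : EuclideanSpace ℂ (A × B)) (h1 : ‖φ‖ = 1) (V : Matrix A A ℂ) (G : Matrix A B ℂ)
    (s : A → ℝ) (hV : V.conjTranspose * V = 1)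
    (hG : G * G.conjTranspose = Matrix.diagonal (fun k => ((s k : ℂ)) ^ 2))
    (hφ : coeffMatrix φ = V * G) : ∑ k, s k ^ 2 = 1 := by
  have hn : ((‖φ‖ ^ 2 : ℝ) : ℂ) = (coeffMatrix φ * (coeffMatrix φ).conjTranspose).trace := by
    rw [EuclideanSpace.norm_sq_eq, Fintype.sum_prod_type, Matrix.trace]
    simp [← norm_sq_eq_mul_conjTranspose, coeffMatrix]
  rw [hφ, Matrix.conjTranspose_mul, Matrix.mul_assoc, ← Matrix.mul_assoc G, hG,
    Matrix.trace_mul_comm, Matrix.mul_assoc, hV, Matrix.mul_one, Matrix.trace_diagonal, h1,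
    one_pow] at hn
  exact_mod_cast hn.symm

/-- The off-diagonal excess of a pure bipartite state is controlled by its concurrence and by the
local dimension. -/
theorem re_trace_mul_Qmat_ketbra_le_min {A B : Type*} [Fintype A] [Fintype B] [DecidableEq A]
    {n m : ℕ} (μ : EuclideanSpace ℝ (Fin n)) (ν : EuclideanSpace ℝ (Fin m))
    (φ : EuclideanSpace ℂ (A × B)) (h1 : ‖φ‖ = 1)
    (W : Matrix (Fin m ⊕ B × B) (Fin n ⊕ A × A) ℂ)
    (hW : ∀ x y, (W * Matrix.vecMulVec x y).trace.re ≤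
      ‖WithLp.toLp 2 x‖ * ‖WithLp.toLp 2 y‖) :
    (W * Qmat μ ν (ketbra φ)).trace.re ≤ √((‖μ‖ ^ 2 + 1) * (‖ν‖ ^ 2 + 1)) +
      min (√((Fintype.card A : ℝ) * ((Fintype.card A : ℝ) - 1)) *
        √(1 - purity (traceSnd (ketbra φ)))) ((Fintype.card A : ℝ) - 1) := by
  obtain ⟨V, G, s, hV, hs0, hG, hφ⟩ := exists_schmidt (coeffMatrix φ)
  have hs := sum_sq_eq_one_of_norm_eq_one φ h1 V G s hV hG hφ
  refine (re_trace_mul_Qmat_ketbra_le μ ν φ V G s hV hs0 hG hφ hs W hW).trans ?_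
  rw [purity_traceSnd_ketbra φ V G s hV hG hφ]
  exact add_le_add le_rfl
    (le_min (sum_erase_mul_le_sqrt s hs) (sum_erase_mul_le_card_sub_one s hs))

/-! ### Ensembles and the three cuts -/

/-- `Q_{μ,ν}` is affine. -/
theorem Qmat_sum_smul {A B : Type*} [Fintype A] [Fintype B] {n m N : ℕ}
    (μ : EuclideanSpace ℝ (Fin n)) (ν : EuclideanSpace ℝ (Fin m)) (p : Fin N → ℝ)
    (hp : ∑ i, p i = 1) (σ : Fin N → Matrix (A × B) (A × B) ℂ) :
    Qmat μ ν (∑ i, (p i : ℂ) • σ i) = ∑ i, (p i : ℂ) • Qmat μ ν (σ i) := by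
  have hpC : ∑ i, (p i : ℂ) = 1 := by exact_mod_cast hp
  ext x y
  rw [Matrix.sum_apply]
  rcases x with i | x <;> rcases y with j | y
  -- The block `μ νᵀ` does not depend on the state; this is where the weights must sum to one.
  · simp [Qmat, Matrix.vecMulVec_apply, ← Finset.sum_mul, hpC]
  · simp only [Qmat, Matrix.fromBlocks_apply₁₂, Matrix.vecMulVec_apply, Matrix.vec, traceFst,
      Matrix.of_apply, Matrix.sum_apply, Matrix.smul_apply, smul_eq_mul]
    rw [Finset.sum_comm, Finset.mul_sum]
    refine Finset.sum_congr rfl fun k _ => ?_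
    rw [← Finset.mul_sum]
    ring
  · simp only [Qmat, Matrix.fromBlocks_apply₂₁, Matrix.vecMulVec_apply, Matrix.vec, traceSnd,
      Matrix.of_apply, Matrix.sum_apply, Matrix.smul_apply, smul_eq_mul]
    rw [Finset.sum_comm, Finset.sum_mul]
    refine Finset.sum_congr rfl fun k _ => ?_
    rw [← Finset.mul_sum]
    ring
  · simp [Qmat, realign, Matrix.vec, Matrix.sum_apply]

/-- The bound on the trace norm of `Q_{μ,ν}` of an ensemble of pure bipartite states. -/
theorem traceNorm_Qmat_ensemble_le {A B : Type*} [Fintype A] [Fintype B] [DecidableEq A]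
    [DecidableEq B] {n m N : ℕ}
    (μ : EuclideanSpace ℝ (Fin n)) (ν : EuclideanSpace ℝ (Fin m)) (p : Fin N → ℝ)
    (hp0 : ∀ i, 0 ≤ p i) (hp : ∑ i, p i = 1) (φ : Fin N → EuclideanSpace ℂ (A × B))
    (hφ : ∀ i, ‖φ i‖ = 1) :
    traceNorm (Qmat μ ν (∑ i, (p i : ℂ) • ketbra (φ i))) ≤
      √((‖μ‖ ^ 2 + 1) * (‖ν‖ ^ 2 + 1)) +
      ∑ i, p i * min (√((Fintype.card A : ℝ) * ((Fintype.card A : ℝ) - 1)) *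
        √(1 - purity (traceSnd (ketbra (φ i))))) ((Fintype.card A : ℝ) - 1) := by
  -- One functional, chosen for the mixture, serves all its pure components and replaces the
  -- triangle inequality for the trace norm.
  obtain ⟨W, hW, hW'⟩ := exists_traceNorm_eq_trace_mul (Qmat μ ν (∑ i, (p i : ℂ) • ketbra (φ i)))
  rw [hW, Qmat_sum_smul μ ν p hp]
  simp only [Matrix.mul_sum, Matrix.mul_smul, Matrix.trace_sum, Matrix.trace_smul, Complex.re_sum,
    smul_eq_mul, Complex.re_ofReal_mul]
  calc _ ≤ ∑ i, p i * (√((‖μ‖ ^ 2 + 1) * (‖ν‖ ^ 2 + 1)) +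
        min (√((Fintype.card A : ℝ) * ((Fintype.card A : ℝ) - 1)) *
        √(1 - purity (traceSnd (ketbra (φ i))))) ((Fintype.card A : ℝ) - 1)) :=
        Finset.sum_le_sum fun i _ => mul_le_mul_of_nonneg_left
          (re_trace_mul_Qmat_ketbra_le_min μ ν (φ i) (hφ i) W hW') (hp0 i)
    _ = _ := by
      simp only [mul_add, Finset.sum_add_distrib]
      rw [← Finset.sum_mul, hp, one_mul]

/-- The components of a vector, with the index set renamed. -/
noncomputable def reindexVec {ι κ : Type*} (e : κ → ι) (φ : EuclideanSpace ℂ ι) :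
    EuclideanSpace ℂ κ :=
  WithLp.toLp 2 fun x => φ (e x)

theorem norm_reindexVec {ι κ : Type*} [Fintype ι] [Fintype κ] {e : κ → ι}
    (he : Function.Bijective e) (φ : EuclideanSpace ℂ ι) : ‖reindexVec e φ‖ = ‖φ‖ := by
  rw [EuclideanSpace.norm_eq, EuclideanSpace.norm_eq]
  congr 1
  exact he.sum_comp fun i => ‖φ i‖ ^ 2

theorem submatrix_ketbra {ι κ : Type*} (e : κ → ι) (φ : EuclideanSpace ℂ ι) :
    (ketbra φ).submatrix e e = ketbra (reindexVec e φ) := rfl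

/-- The bound on the trace norm of `Q_{μ,ν}` under a bipartition given by renaming indices. -/
theorem traceNorm_Qmat_submatrix_le {d n m N : ℕ}
    (μ : EuclideanSpace ℝ (Fin n)) (ν : EuclideanSpace ℝ (Fin m))
    (ρ : Matrix (Tri d) (Tri d) ℂ) (p : Fin N → ℝ) (φ : Fin N → EuclideanSpace ℂ (Tri d))
    (h : IsEnsemble ρ p φ) {e : Tri d → Tri d} (he : Function.Bijective e) :
    traceNorm (Qmat μ ν (ρ.submatrix e e)) ≤ √((‖μ‖ ^ 2 + 1) * (‖ν‖ ^ 2 + 1)) +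
      ∑ i, p i * min (√((d : ℝ) * ((d : ℝ) - 1)) *
        √(1 - purity (traceSnd ((ketbra (φ i)).submatrix e e)))) ((d : ℝ) - 1) := by
  obtain ⟨hp0, hp, hφ, rfl⟩ := h
  have hρ : (∑ i, (p i : ℂ) • ketbra (φ i)).submatrix e e =
      ∑ i, (p i : ℂ) • ketbra (reindexVec e (φ i)) := by
    ext x y
    simp [Matrix.sum_apply, ← submatrix_ketbra]
  have h := traceNorm_Qmat_ensemble_le μ ν p hp0 hp (fun i => reindexVec e (φ i))
    (fun i => by rw [norm_reindexVec he, hφ i])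
  rw [hρ]
  simpa only [Fintype.card_fin, submatrix_ketbra] using h

/-- The summand attaining the minimum is bounded by its first entry, the other two by `D`. -/
theorem sum_min_le_mul_sqrt_min (c D x y z : ℝ) :
    min (c * √x) D + min (c * √y) D + min (c * √z) D ≤ c * √(min x (min y z)) + 2 * D := by
  rcases min_choice x (min y z) with h | h
  · rw [h]
    linarith [min_le_left (c * √x) D, min_le_right (c * √y) D, min_le_right (c * √z) D]
  · rw [h]
    rcases min_choice y z with h | h <;> rw [h]
    · linarith [min_le_right (c * √x) D, min_le_left (c * √y) D, min_le_right (c * √z) D]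
    · linarith [min_le_right (c * √x) D, min_le_right (c * √y) D, min_le_left (c * √z) D]

theorem theorem6 (d : ℕ) (hd : 2 ≤ d) (n m : ℕ)
    (μ : EuclideanSpace ℝ (Fin n)) (ν : EuclideanSpace ℝ (Fin m))
    (ρ : Matrix (Tri d) (Tri d) ℂ) (hρ : IsState ρ) :
    GMEConcurrence ρ ≥ 1 / √((d : ℝ) * ((d : ℝ) - 1)) *
      (Qavg μ ν ρ - √((‖μ‖ ^ 2 + 1) * (‖ν‖ ^ 2 + 1)) - 2 * ((d : ℝ) - 1) / 3) := by
  refine le_csInf (ensembleGME_nonempty hρ) ?_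
  rintro _ ⟨N, p, φ, h, rfl⟩
  have hd' : (2 : ℝ) ≤ d := by exact_mod_cast hd
  have hc : 0 < √((d : ℝ) * ((d : ℝ) - 1)) := Real.sqrt_pos.2 (by nlinarith)
  have e1 := traceNorm_Qmat_submatrix_le μ ν ρ p φ h (e := fun x => x) Function.bijective_id
  have e2 := traceNorm_Qmat_submatrix_le μ ν ρ p φ h (e := fun x => (x.2.1, x.1, x.2.2))
    (Function.Involutive.bijective fun _ => rfl)
  have e3 := traceNorm_Qmat_submatrix_le μ ν ρ p φ h (e := fun x => (x.2.1, x.2.2, x.1))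
    (Function.bijective_iff_has_inverse.2
      ⟨fun x => (x.2.2, x.1, x.2.1), fun _ => rfl, fun _ => rfl⟩)
  have key := Finset.sum_le_sum fun i (_ : i ∈ Finset.univ) => mul_le_mul_of_nonneg_left
    (sum_min_le_mul_sqrt_min √((d : ℝ) * ((d : ℝ) - 1)) ((d : ℝ) - 1)
      (1 - purity (traceSnd (cut1 (ketbra (φ i)))))
      (1 - purity (traceSnd (cut2 (ketbra (φ i)))))
      (1 - purity (traceSnd (cut3 (ketbra (φ i)))))) (h.1 i)
  simp only [mul_add, Finset.sum_add_distrib] at key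
  rw [← Finset.sum_mul, h.2.1, one_mul] at key
  have hrw : ∑ i, p i * (√((d : ℝ) * ((d : ℝ) - 1)) * √(min
      (1 - purity (traceSnd (cut1 (ketbra (φ i)))))
      (min (1 - purity (traceSnd (cut2 (ketbra (φ i)))))
        (1 - purity (traceSnd (cut3 (ketbra (φ i)))))))) =
      √((d : ℝ) * ((d : ℝ) - 1)) * ∑ i, p i * pureGME (φ i) := by
    rw [Finset.mul_sum]
    exact Finset.sum_congr rfl fun i _ => mul_left_comm _ _ _
  rw [hrw] at key
  -- Averaging the cuts yields only a third of this quantity; nonnegativity allows replacing the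
  -- third by the whole.
  have h0 : 0 ≤ √((d : ℝ) * ((d : ℝ) - 1)) * ∑ i, p i * pureGME (φ i) :=
    mul_nonneg hc.le (Finset.sum_nonneg fun i _ => mul_nonneg (h.1 i) (Real.sqrt_nonneg _))
  rw [one_div, inv_mul_le_iff₀ hc]
  change traceNorm (Qmat μ ν (cut1 ρ)) ≤ _ + ∑ i, p i * min (_ * √(1 - purity (traceSnd
    (cut1 (ketbra (φ i)))))) _ at e1
  change traceNorm (Qmat μ ν (cut2 ρ)) ≤ _ + ∑ i, p i * min (_ * √(1 - purity (traceSnd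
    (cut2 (ketbra (φ i)))))) _ at e2
  change traceNorm (Qmat μ ν (cut3 ρ)) ≤ _ + ∑ i, p i * min (_ * √(1 - purity (traceSnd
    (cut3 (ketbra (φ i)))))) _ at e3
  unfold Qavg
  linarith
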